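/- Let $m \ge 2$ and $n \ge 1$ be integers. Let $\mathcal A = (A_{i_1\cdots i_m})$ be a real tensor of order $m$ and dimension $n$ with all entries nonnegative, and let $a, b \in \mathbb{R}^n$ have positive entries. For a real tensor $\mathcal T$ of order $m$ and dimension $n$ and $x \in \mathbb{R}^n$ let $\mathcal T x^{m-1} \in \mathbb{R}^n$ be the vector with entries $$(\mathcal T x^{m-1})_i = \sum_{i_2,\dots,i_m=1}^n T_{i i_2\cdots i_m}\, x_{i_2}\cdots x_{i_m},$$ and let $x^{[m-1]} = (x_1^{m-1},\dots,x_n^{m-1})^T$. Let $\mathcal E$ be the tensor with entries $E_{i_1 i_2\cdots i_m} = a_{i_1}^{m-1} b_{i_2}\cdots b_{i_m}$, and define $$P(\lambda,x) = \begin{pmatrix} \mathcal A x^{m-1} - \lambda x^{[m-1]} \\ x^T x - 1\end{pmatrix},\qquad Q(\lambda,x) = \begin{pmatrix} \mathcal E x^{m-1} - \lambda x^{[m-1]} \\ x^T x - 1\end{pmatrix},$$ $$H(\lambda,x,t) = (1-t)\,Q(\lambda,x) + t\,P(\lambda,x).$$ Then the set $$H_+^{-1}(0) = \{(\lambda,x,t)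 : \lambda > 0,\ x_i > 0 \text{ for all } i,\ 0 \le t < 1,\ H(\lambda,x,t) = 0\}$$ is a (nonempty) one-dimensional smooth ($C^\infty$) manifold with boundary. More precisely, with the topology induced from $\mathbb{R}\times\mathbb{R}^n\times\mathbb{R}$ it carries the structure of a smooth one-dimensional manifold with boundary for which the inclusion into $\mathbb{R}\times\mathbb{R}^n\times\mathbb{R}$ is a smooth embedding (a topological embedding and an immersion) and whose boundary consists exactly of its points with $t = 0$. -/

import Mathlib

open scoped Manifold ContDiff

/-- A real tensor of order `m` and dimension `n`: an array `A` with entries `A i₁ … iₘ`. -/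
abbrev RTensor (m n : ℕ) : Type := (Fin m → Fin n) → ℝ

namespace RTensor

/-- For a tensor `A` of order `m = k + 1`, the vector `A x ^ (m - 1)` with entries
`∑ i₂ … iₘ, A i i₂ … iₘ * x i₂ * ⋯ * x iₘ`. -/
def contract {k n : ℕ} (A : RTensor (k + 1) n) (x : Fin n → ℝ) : Fin n → ℝ :=
  fun i => ∑ j : Fin k → Fin n, A (Fin.cons i j) * ∏ l, x (j l)

/-- The start tensor `a ^ [m - 1] ∘ b ∘ ⋯ ∘ b` of order `m = k + 1`, with entries
`a i₁ ^ (m - 1) * b i₂ * ⋯ * b iₘ`. -/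
def start (k : ℕ) {n : ℕ} (a b : Fin n → ℝ) : RTensor (k + 1) n :=
  fun I => a (I 0) ^ k * ∏ l : Fin k, b (I l.succ)

/-- The map `(lam, x) ↦ (A x ^ (m - 1) - lam x ^ [m - 1], xᵀ x - 1)` for a tensor `A` of order
`m = k + 1`, where `x ^ [m - 1]` is the entrywise power. -/
def eigenSystem {k n : ℕ} (A : RTensor (k + 1) n) (lam : ℝ) (x : Fin n → ℝ) :
    (Fin n → ℝ) × ℝ :=
  (fun i => A.contract x i - lam * x i ^ k, (∑ i, x i * x i) - 1)

/-- The homotopy `H (lam, x, t) = (1 - t) Q (lam, x) + t P (lam, x)` from the system `Q` of the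
start tensor to the system `P` of `A`. A point `p = (lam, x, t)` is a triple. -/
def homotopy {k n : ℕ} (A : RTensor (k + 1) n) (a b : Fin n → ℝ)
    (p : ℝ × (Fin n → ℝ) × ℝ) : (Fin n → ℝ) × ℝ :=
  (1 - p.2.2) • (start k a b).eigenSystem p.1 p.2.1 + p.2.2 • A.eigenSystem p.1 p.2.1

/-- The positive zero set of the homotopy: all `(lam, x, t)` with `lam > 0`, all `x i > 0`,
`0 ≤ t < 1` and `H (lam, x, t) = 0`. -/
def positiveZeroSet {k n : ℕ} (A : RTensor (k + 1) n) (a b : Fin n → ℝ) :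
    Set (ℝ × (Fin n → ℝ) × ℝ) :=
  {p | 0 < p.1 ∧ (∀ i, 0 < p.2.1 i) ∧ p.2.2 ∈ Set.Ico (0 : ℝ) 1 ∧ A.homotopy a b p = 0}

end RTensor

/-! At each time `t` in `[0, 1)` the homotopy is the eigenvalue system of the single tensor `blend`,
whose entries are positive because those of the start tensor are. Two Perron–Frobenius arguments
follow: such a system has at most one positive solution (`eigenSystem_unique`), and its derivative
in `(lam, x)` is injective there (`eq_zero_of_hasDerivAt_eigenSystem`). So `(t, H)` is a local
diffeomorphism at every point of the set, also across `t = 0`, and `t` is injective on the set.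
Hence `t` is a global chart into `[0, ∞)`. Existence is needed only at `t = 0`, where a solution is
explicit. -/

/-! ### Curves with boundary from local diffeomorphisms -/

section LevelCurve

open Topology Filter Set

variable {E F : Type*} [NormedAddCommGroup E] [NormedSpace ℝ E]
  [NormedAddCommGroup F] [NormedSpace ℝ F]

/-- An analytic local diffeomorphism between normed spaces, with values moved back to the source
space by a linear equivalence, restricts to a chart of the source space. -/
lemma ContDiffAt.exists_chart_eq [CompleteSpace E] {G : Type*} [NormedAddCommGroup G]
    [NormedSpace ℝ G] {f : E → G} {L : E ≃L[ℝ] G} {p : E}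
    (hf : ContDiffAt ℝ ω f p) (hL : HasFDerivAt f (L : E →L[ℝ] G) p) :
    ∃ e ∈ IsManifold.maximalAtlas 𝓘(ℝ, E) ∞ E, p ∈ e.source ∧ ∀ q, e q = L.symm (f q) := by
  have hω : (ω : ℕ∞ω) ≠ 0 := by simp
  have hω' : (ω : ℕ∞ω) ≠ ∞ := by simp
  have hg : ContDiffAt ℝ ω (fun q => L.symm (f q)) p := L.symm.contDiff.contDiffAt.comp p hf
  have hg' : HasFDerivAt (fun q => L.symm (f q)) ((ContinuousLinearEquiv.refl ℝ E : E ≃L[ℝ] E) :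
      E →L[ℝ] E) p := by
    have := L.symm.hasFDerivAt.comp p hL
    convert! this using 1
    ext; simp
  let e := hg.toOpenPartialHomeomorph _ hg' hω
  have hpe : p ∈ e.source := hg.mem_toOpenPartialHomeomorph_source hg' hω
  -- Regularity `ω` at a point persists nearby; regularity `∞` at a point need not.
  refine ⟨e.restrContDiff ℝ ω hω', ?_, ?_, fun q => rfl⟩
  · apply OpenPartialHomeomorph.mem_maximalAtlas_of_contMDiffOn
    · exact ((e.contDiffOn_restrContDiff_source ℝ hω').of_le (by simp)).contMDiffOn
    · exact ((e.contDiffOn_restrContDiff_target ℝ hω').of_le (by simp)).contMDiffOn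
  · simp only [OpenPartialHomeomorph.restrContDiff_source]
    refine ⟨hpe, hg, ?_⟩
    exact hg.to_localInverse hg' hω

/-- The coordinate of a line as a continuous linear equivalence. -/
noncomputable def euclideanLineEquiv : EuclideanSpace ℝ (Fin 1) ≃L[ℝ] ℝ :=
  (EuclideanSpace.equiv (Fin 1) ℝ).trans (ContinuousLinearEquiv.funUnique (Fin 1) ℝ ℝ)

/-- The half line `[0, ∞)` as the Euclidean half space of dimension one. -/
noncomputable def halfLine : {s : ℝ // 0 ≤ s} ≃ₜ EuclideanHalfSpace 1 where
  toFun s := ⟨WithLp.toLp 2 fun _ => s.1, s.2⟩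
  invFun v := ⟨v.1 0, v.2⟩
  left_inv _ := rfl
  right_inv v := by
    ext i
    fin_cases i
    rfl
  continuous_toFun := by fun_prop
  continuous_invFun := by fun_prop

/-- Let `S` be locally the set where `Φ` takes values in `[0, ∞) × {0}`, where `Φ` is a local
diffeomorphism at every point of `S`, and let the first component of `Φ` be injective on `S`.
Then this component makes `S` a smooth curve with boundary. -/
theorem exists_smoothEmbedding_of_localDiffeomorph [CompleteSpace E] {S : Set E} {Φ : E → ℝ × F}
    (hne : S.Nonempty) (hΦ : ContDiff ℝ ω Φ)
    (hS : ∀ p ∈ S, 0 ≤ (Φ p).1 ∧ (Φ p).2 = 0)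
    (hloc : ∀ p ∈ S, ∀ᶠ q in 𝓝 p, 0 ≤ (Φ q).1 → (Φ q).2 = 0 → q ∈ S)
    (hderiv : ∀ p ∈ S, ∃ L : E ≃L[ℝ] ℝ × F, HasFDerivAt Φ (L : E →L[ℝ] ℝ × F) p)
    (hinj : InjOn (fun p => (Φ p).1) S) :
    ∃ _ : ChartedSpace (EuclideanHalfSpace 1) S,
      IsManifold (𝓡∂ 1) ∞ S ∧
      Manifold.IsSmoothEmbedding (𝓡∂ 1) 𝓘(ℝ, E) ∞ (Subtype.val : S → E) ∧
      (𝓡∂ 1).boundary S = {p | (Φ p.1).1 = 0} := by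
  have : Nonempty S := hne.to_subtype
  let τ : S → {s : ℝ // 0 ≤ s} := fun p => ⟨(Φ p).1, (hS p p.2).1⟩
  have hτc : Continuous τ :=
    Continuous.subtype_mk (continuous_fst.comp (hΦ.continuous.comp continuous_subtype_val)) _
  have hτi : Function.Injective τ := fun p q h =>
    Subtype.ext (hinj p.2 q.2 (congrArg Subtype.val h))
  -- The local inverse of `Φ` along `(s, 0)` lifts every `s ≥ 0` near `τ p` to a point of `S` near
  -- `p`.
  have hτo : IsOpenMap τ := by
    refine isOpenMap_iff_nhds_le.2 fun p => ?_
    obtain ⟨L, hL⟩ := hderiv p p.2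
    have hω : (ω : ℕ∞ω) ≠ 0 := by simp
    have hp := hΦ.contDiffAt (x := p.1)
    let e := hp.toOpenPartialHomeomorph Φ hL hω
    have hpe : p.1 ∈ e.source := hp.mem_toOpenPartialHomeomorph_source hL hω
    let c : {s : ℝ // 0 ≤ s} → ℝ × F := fun s => (s.1, 0)
    have hcp : c (τ p) = e p.1 := Prod.ext rfl (hS p p.2).2.symm
    have hc : Tendsto c (𝓝 (τ p)) (𝓝 (e p.1)) := by
      rw [← hcp]
      exact Continuous.tendsto (by fun_prop) _
    have hlim : Tendsto (fun s => e.symm (c s)) (𝓝 (τ p)) (𝓝 p.1) :=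
      (e.tendsto_symm hpe).comp hc
    have hright : ∀ᶠ s in 𝓝 (τ p), Φ (e.symm (c s)) = c s := by
      filter_upwards [hc.eventually (e.open_target.mem_nhds (e.map_source hpe))] with s hs
      exact e.right_inv hs
    have hmem : ∀ᶠ s in 𝓝 (τ p), e.symm (c s) ∈ S := by
      filter_upwards [hlim.eventually (hloc p p.2), hright] with s hs hr
      rw [hr] at hs
      exact hs s.2 rfl
    intro U hU
    obtain ⟨V, hV, hVU⟩ := mem_nhds_subtype _ _ _ |>.1 (mem_map.1 hU)
    filter_upwards [hlim.eventually hV, hright, hmem] with s hsV hr hs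
    have h1 : τ ⟨_, hs⟩ ∈ U := hVU (show e.symm (c s) ∈ V from hsV)
    have h2 : τ ⟨_, hs⟩ = s := Subtype.ext (show (Φ (e.symm (c s))).1 = s.1 by rw [hr])
    rwa [h2] at h1
  have hφ : IsOpenEmbedding (fun p : S => halfLine (τ p)) :=
    halfLine.isOpenEmbedding.comp (.of_continuous_injective_isOpenMap hτc hτi hτo)
  let _ := hφ.singletonChartedSpace
  have hM : IsManifold (𝓡∂ 1) ∞ S := hφ.isManifold_singleton
  refine ⟨hφ.singletonChartedSpace, hM, ⟨?_, .subtypeVal⟩, ?_⟩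
  · refine Manifold.IsImmersionOfComplement.isImmersion (F := F) fun p => ?_
    obtain ⟨L, hL⟩ := hderiv p p.2
    obtain ⟨e, he, hpe, heq⟩ := hΦ.contDiffAt.exists_chart_eq hL
    -- In the charts `τ` and `L.symm ∘ Φ` the inclusion reads `s ↦ L.symm (s, 0)`.
    refine Manifold.IsImmersionAtOfComplement.mk_of_continuousAt
      continuous_subtype_val.continuousAt
      ((euclideanLineEquiv.prodCongr (.refl ℝ F)).trans L.symm)
      (chartAt (EuclideanHalfSpace 1) p) e (mem_chart_source _ p) hpe
      (IsManifold.chart_mem_maximalAtlas p) he fun v hv => ?_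
    obtain ⟨q, rfl⟩ : ∃ q : S, (𝓡∂ 1) (halfLine (τ q)) = v := by
      refine ⟨((chartAt (EuclideanHalfSpace 1) p).extend (𝓡∂ 1)).symm v, ?_⟩
      exact ((chartAt (EuclideanHalfSpace 1) p).extend (𝓡∂ 1)).right_inv hv
    have hq : ((chartAt (EuclideanHalfSpace 1) p).extend (𝓡∂ 1)).symm
        ((𝓡∂ 1) (halfLine (τ q))) = q := by
      refine ((chartAt (EuclideanHalfSpace 1) p).extend (𝓡∂ 1)).left_inv ?_
      simp only [OpenPartialHomeomorph.extend_source]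
      exact mem_univ q
    simp only [Function.comp_apply, hq]
    simp only [OpenPartialHomeomorph.extend_coe, modelWithCornersSelf_coe, Function.comp_apply,
      id_eq, heq, ContinuousLinearEquiv.trans_apply]
    congr 1
    exact Prod.ext rfl (hS q q.2).2
  · ext p
    change (𝓡∂ 1).IsBoundaryPoint p ↔ _
    rw [ModelWithCorners.isBoundaryPoint_iff, frontier_range_modelWithCornersEuclideanHalfSpace]
    exact eq_comm

end LevelCurve

/-! ### Perron–Frobenius theory for positive tensors -/

namespace RTensor

variable {k n : ℕ}

/-- The convex combination of the start tensor and `A` at time `t`. -/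
def blend (A : RTensor (k + 1) n) (a b : Fin n → ℝ) (t : ℝ) : RTensor (k + 1) n :=
  fun I => (1 - t) * start k a b I + t * A I

lemma start_pos {a b : Fin n → ℝ} (ha : ∀ i, 0 < a i) (hb : ∀ i, 0 < b i)
    (I : Fin (k + 1) → Fin n) : 0 < start k a b I :=
  mul_pos (pow_pos (ha _) _) (Finset.prod_pos fun _ _ => hb _)

lemma blend_pos {A : RTensor (k + 1) n} (hA : ∀ I, 0 ≤ A I) {a b : Fin n → ℝ}
    (ha : ∀ i, 0 < a i) (hb : ∀ i, 0 < b i) {t : ℝ} (ht : t ∈ Set.Ico (0 : ℝ) 1)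
    (I : Fin (k + 1) → Fin n) : 0 < A.blend a b t I :=
  add_pos_of_pos_of_nonneg (mul_pos (sub_pos.2 ht.2) (start_pos ha hb I)) (mul_nonneg ht.1 (hA I))

lemma homotopy_eq (A : RTensor (k + 1) n) (a b : Fin n → ℝ) (p : ℝ × (Fin n → ℝ) × ℝ) :
    A.homotopy a b p = (A.blend a b p.2.2).eigenSystem p.1 p.2.1 := by
  refine Prod.ext (funext fun i => ?_) ?_
  · have h : (A.blend a b p.2.2).contract p.2.1 i =
        (1 - p.2.2) * (start k a b).contract p.2.1 i + p.2.2 * A.contract p.2.1 i := by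
      simp only [contract, blend, Finset.mul_sum, ← Finset.sum_add_distrib]
      exact Finset.sum_congr rfl fun _ _ => by ring
    simp only [homotopy, eigenSystem, Prod.fst_add, Prod.smul_fst, Pi.add_apply, Pi.smul_apply,
      smul_eq_mul, h]
    ring
  · simp only [homotopy, eigenSystem, Prod.snd_add, Prod.smul_snd, smul_eq_mul]
    ring

lemma eigenSystem_eq_zero_iff {B : RTensor (k + 1) n} {lam : ℝ} {x : Fin n → ℝ} :
    B.eigenSystem lam x = 0 ↔
      (∀ i, B.contract x i = lam * x i ^ k) ∧ ∑ i, x i * x i = 1 := by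
  simp only [eigenSystem, Prod.mk_eq_zero, funext_iff, Pi.zero_apply, sub_eq_zero]

lemma contract_mul (B : RTensor (k + 1) n) (y w : Fin n → ℝ) (i : Fin n) :
    B.contract (fun j => y j * w j) i =
      ∑ J : Fin k → Fin n, B (Fin.cons i J) * (∏ l, y (J l)) * ∏ l, w (J l) := by
  simp only [contract, Finset.prod_mul_distrib, mul_assoc]

/-- Eigenvalues of a positive tensor with positive eigenvectors compare to each other, and the
eigenvectors are proportional. -/
lemma eigen_le_of_pos (hk : 1 ≤ k) (hn : 1 ≤ n) {B : RTensor (k + 1) n} (hB : ∀ I, 0 < B I)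
    {lam mu : ℝ} {x y : Fin n → ℝ} (hx : ∀ i, 0 < x i) (hy : ∀ i, 0 < y i)
    (hex : ∀ i, B.contract x i = lam * x i ^ k) (hey : ∀ i, B.contract y i = mu * y i ^ k) :
    mu ≤ lam ∧ (lam ≤ mu → ∃ c : ℝ, 0 < c ∧ ∀ j, x j = c * y j) := by
  have : Nonempty (Fin n) := ⟨⟨0, hn⟩⟩
  -- At a minimal ratio, every product of `k` ratios is at least `w i ^ k`, so row `i` determines
  -- the sign of `lam - mu`.
  obtain ⟨i, hi⟩ := Finite.exists_min fun j => x j / y j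
  set w : Fin n → ℝ := fun j => x j / y j with hw
  have hxw : x = fun j => y j * w j := by
    funext j
    simp only [hw]
    field_simp [(hy j).ne']
  have hc : 0 < w i := div_pos (hx i) (hy i)
  have hsum : ∑ J : Fin k → Fin n, B (Fin.cons i J) * (∏ l, y (J l)) *
      (∏ l, w (J l) - w i ^ k) = (lam - mu) * (y i ^ k * w i ^ k) := by
    have h1 := hex i
    have h2 := hey i
    rw [hxw, contract_mul] at h1
    simp only [contract] at h2
    simp only [mul_sub, Finset.sum_sub_distrib, ← Finset.sum_mul, h1, h2, mul_pow]
    ring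
  have hpow : ∀ J : Fin k → Fin n, w i ^ k ≤ ∏ l, w (J l) := fun J => by
    simpa using Finset.prod_le_prod (s := Finset.univ) (f := fun _ : Fin k => w i)
      (g := fun l => w (J l)) (fun _ _ => hc.le) fun l _ => hi (J l)
  have hcoef : ∀ J : Fin k → Fin n, 0 < B (Fin.cons i J) * ∏ l, y (J l) := fun J =>
    mul_pos (hB _) (Finset.prod_pos fun _ _ => hy _)
  have hterm : ∀ J ∈ (Finset.univ : Finset (Fin k → Fin n)), 0 ≤ B (Fin.cons i J) *
      (∏ l, y (J l)) * (∏ l, w (J l) - w i ^ k) := fun J _ =>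
    mul_nonneg (hcoef J).le (sub_nonneg.2 (hpow J))
  have hyw : 0 < y i ^ k * w i ^ k := mul_pos (pow_pos (hy i) k) (pow_pos hc k)
  have hle : mu ≤ lam := by
    have h := Finset.sum_nonneg hterm
    rw [hsum] at h
    exact sub_nonneg.1 (nonneg_of_mul_nonneg_left h hyw)
  refine ⟨hle, fun hge => ⟨w i, hc, fun j => ?_⟩⟩
  rw [le_antisymm hge hle, sub_self, zero_mul, Finset.sum_eq_zero_iff_of_nonneg hterm] at hsum
  -- The constant multi-index gives `w j ^ k = w i ^ k`.
  have h := hsum (fun _ => j) (Finset.mem_univ _)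
  rw [mul_eq_zero, or_iff_right (hcoef _).ne', sub_eq_zero, Finset.prod_const, Finset.card_univ,
    Fintype.card_fin, pow_left_inj₀ (hc.le.trans (hi j)) hc.le (by lia)] at h
  exact (div_eq_iff (hy j).ne').1 h

/-- A positive tensor has at most one normalized positive eigenvector. -/
lemma eigenSystem_unique (hk : 1 ≤ k) (hn : 1 ≤ n) {B : RTensor (k + 1) n} (hB : ∀ I, 0 < B I)
    {lam mu : ℝ} {x y : Fin n → ℝ} (hx : ∀ i, 0 < x i) (hy : ∀ i, 0 < y i)
    (hex : B.eigenSystem lam x = 0) (hey : B.eigenSystem mu y = 0) : lam = mu ∧ x = y := by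
  rw [eigenSystem_eq_zero_iff] at hex hey
  have h1 := eigen_le_of_pos hk hn hB hx hy hex.1 hey.1
  have h2 := eigen_le_of_pos hk hn hB hy hx hey.1 hex.1
  obtain ⟨c, hc, hxy⟩ := h1.2 h2.1
  refine ⟨le_antisymm h2.1 h1.1, ?_⟩
  have hc2 : c * c = 1 := by
    have h : ∑ i, x i * x i = c * c * ∑ i, y i * y i := by
      rw [Finset.mul_sum]
      exact Finset.sum_congr rfl fun i _ => by rw [hxy i]; ring
    rwa [hex.2, hey.2, mul_one, eq_comm] at h
  have hc1 : c = 1 := by nlinarith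
  funext j
  rw [hxy j, hc1, one_mul]

/-- The derivative of the eigenvalue system of a positive tensor is injective at a positive
solution. -/
lemma eq_zero_of_hasDerivAt_eigenSystem (hk : 1 ≤ k) (hn : 1 ≤ n) {B : RTensor (k + 1) n}
    (hB : ∀ I, 0 < B I) {lam mu : ℝ} {x v : Fin n → ℝ} (hx : ∀ i, 0 < x i)
    (hex : B.eigenSystem lam x = 0)
    (hd : HasDerivAt (fun s : ℝ => B.eigenSystem (lam + s * mu) (x + s • v)) 0 0) :
    mu = 0 ∧ v = 0 := by
  have : Nonempty (Fin n) := ⟨⟨0, hn⟩⟩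
  rw [eigenSystem_eq_zero_iff] at hex
  set w : Fin n → ℝ := fun j => v j / x j with hw
  have hxv : ∀ s : ℝ, x + s • v = fun j => x j * (1 + s * w j) := fun s => by
    funext j
    simp only [hw, Pi.add_apply, Pi.smul_apply, smul_eq_mul]
    field_simp [(hx j).ne']
  have hlin : ∀ j, HasDerivAt (fun s : ℝ => 1 + s * w j) (w j) 0 := fun j => by
    simpa using ((hasDerivAt_id (0 : ℝ)).mul_const (w j)).const_add 1
  -- Row `i` of the linearized system: the eigenvalue equation absorbs the `lam` term, so only
  -- differences of relative increments `w` remain.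
  have hcon : ∀ i, ∑ J : Fin k → Fin n, B (Fin.cons i J) * (∏ l, x (J l)) *
      ∑ l, (w (J l) - w i) = mu * x i ^ k := fun i => by
    have h1 : HasDerivAt (fun s : ℝ => (B.eigenSystem (lam + s * mu) (x + s • v)).1 i) 0 0 := by
      have := hasDerivAt_pi.1 hd.hasFDerivAt.fst.hasDerivAt i
      simpa using this
    have h2 : HasDerivAt (fun s : ℝ => (B.eigenSystem (lam + s * mu) (x + s • v)).1 i)
        (∑ J : Fin k → Fin n, B (Fin.cons i J) * (∏ l, x (J l)) * ∑ l, w (J l) -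
          (mu * x i ^ k + lam * (x i ^ k * (k * w i)))) 0 := by
      simp only [eigenSystem, hxv, contract_mul, mul_pow]
      refine HasDerivAt.sub (HasDerivAt.fun_sum fun J _ => ?_) ?_
      · have h := HasDerivAt.fun_finsetProd (u := Finset.univ)
          (fun l (_ : l ∈ Finset.univ) => hlin (J l))
        simpa using h.const_mul (B (Fin.cons i J) * ∏ l, x (J l))
      · have ha : HasDerivAt (fun s : ℝ => lam + s * mu) mu 0 := by
          simpa using ((hasDerivAt_id (0 : ℝ)).mul_const mu).const_add lam
        simpa using ha.fun_mul (((hlin i).fun_pow k).const_mul (x i ^ k))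
    have h3 := h2.unique h1
    have h4 := hex.1 i
    simp only [contract] at h4
    simp only [Finset.sum_sub_distrib, mul_sub, Finset.sum_const, Finset.card_univ,
      Fintype.card_fin, nsmul_eq_mul, ← Finset.sum_mul, h4]
    linarith
  have hnorm : ∑ i, x i * x i * w i = 0 := by
    have h1 : HasDerivAt (fun s : ℝ => (B.eigenSystem (lam + s * mu) (x + s • v)).2) 0 0 := by
      simpa using! hd.hasFDerivAt.snd.hasDerivAt
    have h2 : HasDerivAt (fun s : ℝ => (B.eigenSystem (lam + s * mu) (x + s • v)).2)
        (∑ i, 2 * (x i * x i * w i)) 0 := by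
      simp only [eigenSystem, hxv]
      refine (HasDerivAt.fun_sum fun i _ => ?_).sub_const 1
      have h := ((hlin i).const_mul (x i)).mul ((hlin i).const_mul (x i))
      convert! h using 1
      ring
    have h3 := h2.unique h1
    rw [← Finset.mul_sum] at h3
    linarith
  have hcoef : ∀ i (J : Fin k → Fin n), 0 < B (Fin.cons i J) * ∏ l, x (J l) := fun i J =>
    mul_pos (hB _) (Finset.prod_pos fun _ _ => hx _)
  -- The row of the minimum forces `mu ≥ 0`, that of the maximum `mu ≤ 0`.
  obtain ⟨i, hi⟩ := Finite.exists_min w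
  obtain ⟨j, hj⟩ := Finite.exists_max w
  have hterm : ∀ J ∈ (Finset.univ : Finset (Fin k → Fin n)), 0 ≤ B (Fin.cons i J) *
      (∏ l, x (J l)) * ∑ l, (w (J l) - w i) := fun J _ =>
    mul_nonneg (hcoef i J).le (Finset.sum_nonneg fun l _ => sub_nonneg.2 (hi _))
  have hmu0 : 0 ≤ mu := by
    have h := Finset.sum_nonneg hterm
    rw [hcon i] at h
    exact nonneg_of_mul_nonneg_left h (pow_pos (hx i) k)
  have hmu1 : mu ≤ 0 := by
    have h : mu * x j ^ k ≤ 0 := by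
      rw [← hcon j]
      exact Finset.sum_nonpos fun J _ => mul_nonpos_of_nonneg_of_nonpos (hcoef j J).le
        (Finset.sum_nonpos fun l _ => sub_nonpos.2 (hj _))
    exact nonpos_of_mul_nonpos_left h (pow_pos (hx j) k)
  have hmu : mu = 0 := le_antisymm hmu1 hmu0
  have hconst : ∀ l, w l = w i := fun l => by
    have h := hcon i
    rw [hmu, zero_mul, Finset.sum_eq_zero_iff_of_nonneg hterm] at h
    have h := h (fun _ => l) (Finset.mem_univ _)
    rw [mul_eq_zero, or_iff_right (hcoef _ _).ne', Finset.sum_const, Finset.card_univ,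
      Fintype.card_fin, nsmul_eq_mul, mul_eq_zero, or_iff_right, sub_eq_zero] at h
    · exact h
    · exact_mod_cast (show k ≠ 0 by lia)
  -- The linearized normalization kills the remaining scaling direction.
  simp only [hconst, ← Finset.sum_mul, hex.2, one_mul] at hnorm
  refine ⟨hmu, funext fun l => ?_⟩
  have h : v l / x l = 0 := (hconst l).trans hnorm
  simpa [(hx l).ne'] using h

/-! ### The homotopy as a local diffeomorphism, and its start point -/

/-- The homotopy together with its time parameter. -/
def timedHomotopy (A : RTensor (k + 1) n) (a b : Fin n → ℝ) (p : ℝ × (Fin n → ℝ) × ℝ) :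
    ℝ × (Fin n → ℝ) × ℝ :=
  (p.2.2, A.homotopy a b p)

lemma contDiff_timedHomotopy (A : RTensor (k + 1) n) (a b : Fin n → ℝ) :
    ContDiff ℝ ω (A.timedHomotopy a b) := by
  unfold timedHomotopy homotopy eigenSystem contract
  have hx : ∀ i, ContDiff ℝ ω fun p : ℝ × (Fin n → ℝ) × ℝ => p.2.1 i := fun i => by fun_prop
  have hS : ∀ T : RTensor (k + 1) n, ContDiff ℝ ω fun p : ℝ × (Fin n → ℝ) × ℝ =>
      ((fun i => ∑ j : Fin k → Fin n, T (Fin.cons i j) * ∏ l, p.2.1 (j l) - p.1 * p.2.1 i ^ k,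
        (∑ i, p.2.1 i * p.2.1 i) - 1) : (Fin n → ℝ) × ℝ) := fun T => by
    refine ContDiff.prodMk (contDiff_pi.2 fun i => ContDiff.sub ?_ ?_) (ContDiff.sub ?_ ?_)
    · exact ContDiff.sum fun J _ => contDiff_const.mul (contDiff_prod fun l _ => hx _)
    · exact contDiff_fst.mul ((hx i).pow k)
    · exact ContDiff.sum fun i _ => (hx i).mul (hx i)
    · exact contDiff_const
  have ht : ContDiff ℝ ω fun p : ℝ × (Fin n → ℝ) × ℝ => p.2.2 := by fun_prop
  exact ht.prodMk (((contDiff_const.sub ht).smul (hS _)).add (ht.smul (hS A)))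

/-- Since `t` is itself a component of the map, a kernel vector has no time component and lies in
the kernel of the system at fixed `t`, which is trivial. In finite dimension injectivity suffices.
-/
lemma exists_hasFDerivAt_timedHomotopy (hk : 1 ≤ k) (hn : 1 ≤ n) {A : RTensor (k + 1) n}
    (hA : ∀ I, 0 ≤ A I) {a b : Fin n → ℝ} (ha : ∀ i, 0 < a i) (hb : ∀ i, 0 < b i)
    {p : ℝ × (Fin n → ℝ) × ℝ} (hp : p ∈ A.positiveZeroSet a b) :
    ∃ L : (ℝ × (Fin n → ℝ) × ℝ) ≃L[ℝ] ℝ × (Fin n → ℝ) × ℝ,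
      HasFDerivAt (A.timedHomotopy a b) (L : _ →L[ℝ] ℝ × (Fin n → ℝ) × ℝ) p := by
  obtain ⟨-, hx, ht, h0⟩ := hp
  have hd : HasFDerivAt (A.timedHomotopy a b) (fderiv ℝ (A.timedHomotopy a b) p) p :=
    ((A.contDiff_timedHomotopy a b).differentiable (by simp) p).hasFDerivAt
  set D := fderiv ℝ (A.timedHomotopy a b) p
  have hker : ∀ v, D v = 0 → v = 0 := by
    intro v hv
    have hl : HasDerivAt (fun s : ℝ => A.timedHomotopy a b (p + s • v)) 0 0 := by
      simpa [HasLineDerivAt, hv] using hd.hasLineDerivAt v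
    have hv2 : v.2.2 = 0 := by
      have h1 : HasDerivAt (fun s : ℝ => p.2.2 + s * v.2.2) 0 0 := by
        convert! hl.hasFDerivAt.fst.hasDerivAt using 1
        simp
      have h2 : HasDerivAt (fun s : ℝ => p.2.2 + s * v.2.2) v.2.2 0 := by
        simpa using ((hasDerivAt_id (0 : ℝ)).mul_const v.2.2).const_add p.2.2
      exact h2.unique h1
    rw [homotopy_eq] at h0
    have h := eq_zero_of_hasDerivAt_eigenSystem hk hn (blend_pos hA ha hb ht) hx h0
      (mu := v.1) (v := v.2.1) (by
        have h1 : HasDerivAt (fun s : ℝ => A.homotopy a b (p + s • v)) 0 0 := by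
          simpa using! hl.hasFDerivAt.snd.hasDerivAt
        simpa [homotopy_eq, hv2] using h1)
    exact Prod.ext h.1 (Prod.ext h.2 hv2)
  have hinj : Function.Injective (D : (ℝ × (Fin n → ℝ) × ℝ) →ₗ[ℝ] ℝ × (Fin n → ℝ) × ℝ) :=
    (injective_iff_map_eq_zero _).2 hker
  exact ⟨(LinearEquiv.ofInjectiveEndo _ hinj).toContinuousLinearEquiv, hd⟩

lemma positiveZeroSet_nonempty (hn : 1 ≤ n) (A : RTensor (k + 1) n)
    {a b : Fin n → ℝ} (ha : ∀ i, 0 < a i) (hb : ∀ i, 0 < b i) :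
    (A.positiveZeroSet a b).Nonempty := by
  have : Nonempty (Fin n) := ⟨⟨0, hn⟩⟩
  have hs : 0 < ∑ i, a i * a i :=
    Finset.sum_pos (fun i _ => mul_pos (ha i) (ha i)) Finset.univ_nonempty
  have hba : 0 < ∑ i, b i * a i :=
    Finset.sum_pos (fun i _ => mul_pos (hb i) (ha i)) Finset.univ_nonempty
  set r := Real.sqrt (∑ i, a i * a i) with hr
  have hr0 : 0 < r := Real.sqrt_pos.2 hs
  have hrr : r * r = ∑ i, a i * a i := Real.mul_self_sqrt hs.le
  -- The start tensor sends `x` to `(b · x) ^ k a ^ [k]`, so its positive eigenvectors are multiples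
  -- of `a`; `r` normalizes and cancels from the eigenvalue.
  refine ⟨((∑ i, b i * a i) ^ k, fun i => a i / r, 0), pow_pos hba k,
    fun i => div_pos (ha i) hr0, by simp, ?_⟩
  rw [homotopy_eq, eigenSystem_eq_zero_iff]
  refine ⟨fun i => ?_, ?_⟩
  · simp only [contract, blend, start, sub_zero, one_mul, zero_mul, add_zero, Fin.cons_zero,
      Fin.cons_succ, mul_assoc, ← Finset.prod_mul_distrib]
    rw [← Finset.mul_sum, ← Fintype.sum_pow (fun i => b i * (a i / r)) k]
    simp only [← mul_div_assoc, ← Finset.sum_div, div_pow]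
    ring
  · simp only [div_mul_div_comm, ← Finset.sum_div, hrr]
    exact div_self hs.ne'

end RTensor

/-- For a nonnegative tensor `A` of order `m = k + 1 ≥ 2` and dimension `n ≥ 1` and positive
vectors `a`, `b`, the positive zero set of the homotopy is a nonempty smooth one-dimensional
manifold with boundary, smoothly embedded in `ℝ × ℝⁿ × ℝ`, whose boundary is its slice `t = 0`. -/
theorem lemma2p3 (k n : ℕ) (hk : 1 ≤ k) (hn : 1 ≤ n) (A : RTensor (k + 1) n)
    (hA : ∀ I, 0 ≤ A I) (a b : Fin n → ℝ) (ha : ∀ i, 0 < a i) (hb : ∀ i, 0 < b i) :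
    (A.positiveZeroSet a b).Nonempty ∧
    ∃ _ : ChartedSpace (EuclideanHalfSpace 1) (A.positiveZeroSet a b),
      IsManifold (𝓡∂ 1) ∞ (A.positiveZeroSet a b) ∧
      Manifold.IsSmoothEmbedding (𝓡∂ 1) 𝓘(ℝ, ℝ × (Fin n → ℝ) × ℝ) ∞
        (Subtype.val : A.positiveZeroSet a b → ℝ × (Fin n → ℝ) × ℝ) ∧
      (𝓡∂ 1).boundary (A.positiveZeroSet a b) = {p | p.1.2.2 = 0} := by
  refine ⟨RTensor.positiveZeroSet_nonempty hn A ha hb, ?_⟩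
  refine exists_smoothEmbedding_of_localDiffeomorph (Φ := A.timedHomotopy a b)
    (RTensor.positiveZeroSet_nonempty hn A ha hb) (A.contDiff_timedHomotopy a b)
    (fun p hp => ⟨hp.2.2.1.1, hp.2.2.2⟩) (fun p hp => ?_)
    (fun p hp => RTensor.exists_hasFDerivAt_timedHomotopy hk hn hA ha hb hp) ?_
  -- All conditions except `0 ≤ t` and `H = 0` are open.
  · have h1 : ∀ᶠ q : ℝ × (Fin n → ℝ) × ℝ in nhds p, 0 < q.1 :=
      continuous_fst.continuousAt.eventually (lt_mem_nhds hp.1)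
    have h2 : ∀ᶠ q : ℝ × (Fin n → ℝ) × ℝ in nhds p, ∀ i, 0 < q.2.1 i :=
      Filter.eventually_all.2 fun i =>
        (show Continuous fun q : ℝ × (Fin n → ℝ) × ℝ => q.2.1 i by fun_prop).continuousAt.eventually
          (lt_mem_nhds (hp.2.1 i))
    have h3 : ∀ᶠ q : ℝ × (Fin n → ℝ) × ℝ in nhds p, q.2.2 < 1 :=
      
      (show Continuous fun q : ℝ × (Fin n → ℝ) × ℝ => q.2.2 by fun_prop).continuousAt.eventually
        (gt_mem_nhds hp.2.2.1.2)
    filter_upwards [h1, h2, h3] with q hq1 hq2 hq3 ht h0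
    exact ⟨hq1, hq2, ⟨ht, hq3⟩, h0⟩
  · rintro ⟨lam, x, t⟩ ⟨-, hx, ht, hp⟩ ⟨mu, y, s⟩ ⟨-, hy, -, hq⟩ (rfl : t = s)
    rw [RTensor.homotopy_eq] at hp hq
    obtain ⟨rfl, rfl⟩ :=
      RTensor.eigenSystem_unique hk hn (RTensor.blend_pos hA ha hb ht) hx hy hp hq
    rfl
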